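/- **Setting.** A *system* consists of the following data. Let $A$ be a finite-dimensional real vector space and $\Omega\subset A$ a nonempty compact convex set (the *normalized states*) which spans $A$ and lies in an affine hyperplane not containing the origin; let $u_A\in A^*$ be the functional with $u_A(\omega)=1$ for all $\omega\in\Omega$, and let $A_+=\{\lambda\omega:\lambda\ge 0,\ \omega\in\Omega\}$ be the *state cone*. For $e,f\in A^*$ write $e\le f$ if $e(x)\le f(x)$ for all $x\in A_+$. There is a closed convex set $\mathcal E\subseteq\{e\in A^*: 0\le e\le u_A\}$ of *allowed effects* that spans $A^*$, contains $u_A$, contains $u_A-e$ whenever $e\in\mathcal E$, and contains $e+f$ whenever $e,f\in\mathcal E$ and $e+f\le u_A$. There is a set of *allowed transformations*, i.e. of linear maps $T:A\to A$ with $T(A_+)\subseteq A_+$, $u_A(T\omega)\le 1$ for all $\omega\in\Omega$, and $e\circ T\in\mathcal E$ for all $e\in\mathcal E$; this set is topologically closed and closed under composition. An allowed transformation is *reversible* if its inverse exists and is allowed. A *pure state* is an extreme point of $\Omega$. An *$n$-frame* is a list $\omega_1,\dots,\omega_n$ of pure states for which there are $e_1,\dots,e_n\in\mathcal E$ with $\sum_i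 e_i\le u_A$ and $e_i(\omega_j)=\delta_{ij}$ for all $i,j$. A *face* of $A_+$ is a nonempty convex subset $F\subseteq A_+$ such that, whenever a point of $F$ is a convex combination with positive weights of points of $A_+$, all of these points lie in $F$. The faces, ordered by inclusion, form a lattice with $F\wedge G=F\cap G$, $F\vee G$ the smallest face containing $F$ and $G$, greatest element $A_+$ and least element $\{0\}$. **Postulate 1.** Every $\omega\in\Omega$ is of the form $\omega=\sum_{i=1}^n p_i\omega_i$ with $p_i\ge0$, $\sum_i p_i=1$, for some $n$ and some $n$-frame $\omega_1,\dots,\omega_n$. **Postulate 2.** If $\omega_1,\dots,\omega_n$ and $\varphi_1,\dots,\varphi_n$ are $n$-frames for some $n$, then there is a reversible transformation $T$ with $T\omega_i=\varphi_i$ for all $i$. **Theorem.** Suppose that a system satisfies Postulates 1 and 2. Then there is an inner product $\langle\cdot,\cdot\rangle$ on $A$ which is self-dualizing, i.e. $\{y\in A:\langle x,y\rangle\ge0\ \ \forall x\in A_+\}=A_+$, and invariant, i.e. $\langle Tx,Ty\rangle=\langle x,y\rangle$ for all reversible transformations $T$ and all $x,y\in A$. For every such inner product, the set $F':=F^\perp\cap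 A_+$, where $F^\perp=\{x\in A:\langle x,y\rangle=0\ \ \forall y\in F\}$, is a face of $A_+$ for every face $F$ of $A_+$, and with $F\mapsto F'$ the lattice of faces of $A_+$ is an orthomodular lattice: for all faces $F,G$ one has $F''=F$; $F\subseteq G$ implies $G'\subseteq F'$; $F\wedge F'=\{0\}$; $F\vee F'=A_+$; and $F\subseteq G$ implies $G=F\vee(G\wedge F')$. -/

import Mathlib

/-- A (single) system of an operational probabilistic theory, with ambient real vector space `A`
(which is finite-dimensional in all uses).  The norm of `A` only serves to provide the canonical
topologies on `A`, on its dual and on the linear maps `A → A`. -/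
structure ProbSystem (A : Type*) [NormedAddCommGroup A] [NormedSpace ℝ A] where
  /-- The set of normalized states `Ω_A`. -/
  states : Set A
  states_nonempty : states.Nonempty
  states_convex : Convex ℝ states
  states_compact : IsCompact states
  states_span : Submodule.span ℝ states = ⊤
  /-- The unit functional `u_A`; its existence says that the normalized states lie in an affine
  hyperplane which avoids the origin. -/
  unit : StrongDual ℝ A
  unit_apply : ∀ ω ∈ states, unit ω = 1
  /-- The set of allowed effects. -/
  effects : Set (StrongDual ℝ A)
  effects_bounds : ∀ e ∈ effects, ∀ ω ∈ states, 0 ≤ e ω ∧ e ω ≤ 1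
  effects_convex : Convex ℝ effects
  effects_closed : IsClosed effects
  unit_mem : unit ∈ effects
  unit_sub_mem : ∀ e ∈ effects, unit - e ∈ effects
  effects_span : Submodule.span ℝ effects = ⊤
  /-- Coarse-graining: `e + f` is allowed as soon as `e + f ≤ u_A`. -/
  effects_add : ∀ e ∈ effects, ∀ f ∈ effects, (∀ ω ∈ states, e ω + f ω ≤ 1) → e + f ∈ effects
  /-- The set of allowed transformations. -/
  transformations : Set (A →L[ℝ] A)
  transformations_closed : IsClosed transformations
  transformations_comp : ∀ T ∈ transformations, ∀ T' ∈ transformations,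
    T.comp T' ∈ transformations
  /-- Positivity: unnormalized states go to unnormalized states. -/
  transformations_pos : ∀ T ∈ transformations, ∀ ω ∈ states,
    ∃ t : ℝ, 0 ≤ t ∧ ∃ ω' ∈ states, T ω = t • ω'
  transformations_unit_le : ∀ T ∈ transformations, ∀ ω ∈ states, unit (T ω) ≤ 1
  transformations_effects : ∀ T ∈ transformations, ∀ e ∈ effects, e.comp T ∈ effects

namespace ProbSystem

variable {A : Type*} [NormedAddCommGroup A] [NormedSpace ℝ A]

/-- The cone `A_+` of unnormalized states: all nonnegative multiples of normalized states. -/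
def cone (S : ProbSystem A) : PointedCone ℝ A :=
  PointedCone.ofConeComb {x : A | ∃ t : ℝ, 0 ≤ t ∧ ∃ ω ∈ S.states, x = t • ω}
    (by
      obtain ⟨ω, hω⟩ := S.states_nonempty
      exact ⟨1 • ω, 1, zero_le_one, ω, hω, by simp⟩)
    (by
      rintro _ ⟨s, hs, ω, hω, rfl⟩ _ ⟨t, ht, τ, hτ, rfl⟩ a ha b hb
      have h1 : 0 ≤ a * s := mul_nonneg ha hs
      have h2 : 0 ≤ b * t := mul_nonneg hb ht
      rcases eq_or_lt_of_le (add_nonneg h1 h2) with h0 | hpos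
      · have e1 : a * s = 0 := by linarith
        have e2 : b * t = 0 := by linarith
        exact ⟨0, le_rfl, ω, hω, by simp [smul_smul, e1, e2]⟩
      · refine ⟨a * s + b * t, hpos.le,
          (a * s / (a * s + b * t)) • ω + (b * t / (a * s + b * t)) • τ, ?_, ?_⟩
        · refine S.states_convex hω hτ (by positivity) (by positivity) ?_
          field_simp
        · rw [smul_add, smul_smul, smul_smul, smul_smul, smul_smul,
            mul_div_cancel₀ _ hpos.ne', mul_div_cancel₀ _ hpos.ne'])

theorem mem_cone (S : ProbSystem A) (x : A) :
    x ∈ S.cone ↔ ∃ t : ℝ, 0 ≤ t ∧ ∃ ω ∈ S.states, x = t • ω := Iff.rfl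

/-- A reversible transformation: an allowed transformation whose inverse exists and is allowed. -/
def IsReversible (S : ProbSystem A) (T : A →L[ℝ] A) : Prop :=
  T ∈ S.transformations ∧ ∃ T' ∈ S.transformations,
    T'.comp T = ContinuousLinearMap.id ℝ A ∧ T.comp T' = ContinuousLinearMap.id ℝ A

/-- The states `ω 0, …, ω (n - 1)` are perfectly distinguishable: there are allowed effects
`e i` with `∑ i, e i ≤ u_A` (in the order of the dual cone) and `e i (ω j) = δ_{ij}`. -/
def PerfectlyDistinguishable (S : ProbSystem A) {n : ℕ} (ω : Fin n → A) : Prop :=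
  ∃ e : Fin n → StrongDual ℝ A, (∀ i, e i ∈ S.effects) ∧
    (∀ x ∈ S.cone, ∑ i, e i x ≤ S.unit x) ∧
    ∀ i j, e i (ω j) = if i = j then 1 else 0

/-- An `n`-frame: a list of `n` perfectly distinguishable pure states. -/
def IsFrame (S : ProbSystem A) {n : ℕ} (ω : Fin n → A) : Prop :=
  (∀ i, ω i ∈ S.states.extremePoints ℝ) ∧ S.PerfectlyDistinguishable ω

/-- Postulate 1, classical decomposability: every state is a probabilistic mixture of the members
of some frame. -/
def ClassicalDecomposability (S : ProbSystem A) : Prop :=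
  ∀ ω ∈ S.states, ∃ (n : ℕ) (φ : Fin n → A) (p : Fin n → ℝ),
    S.IsFrame φ ∧ (∀ i, 0 ≤ p i) ∧ ∑ i, p i = 1 ∧ ω = ∑ i, p i • φ i

/-- Postulate 2, strong symmetry: any frame is mapped to any other frame of the same size by some
reversible transformation. -/
def StrongSymmetry (S : ProbSystem A) : Prop :=
  ∀ (n : ℕ) (ω φ : Fin n → A), S.IsFrame ω → S.IsFrame φ →
    ∃ T : A →L[ℝ] A, S.IsReversible T ∧ ∀ i, T (ω i) = φ i

/-- The faces of the cone `A_+` (the empty set does not count as a face), ordered by inclusion. -/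
abbrev Face (S : ProbSystem A) : Type _ := {F : PointedCone ℝ A // F.IsFaceOf S.cone}

/-- A set is (the carrier of) a face of `A_+` iff it is a nonempty convex subset that contains, with
any of its points, all members of convex decompositions of this point in `A_+`. -/
theorem exists_face_iff (S : ProbSystem A) (F : Set A) :
    (∃ G : S.Face, (G.1 : Set A) = F) ↔
      F.Nonempty ∧ Convex ℝ F ∧ IsExtreme ℝ (S.cone : Set A) F := by
  constructor
  · rintro ⟨G, rfl⟩
    exact ⟨⟨0, G.1.zero_mem⟩, G.1.convex, G.2.isExtreme⟩
  · rintro ⟨⟨z, hz⟩, hconv, hext⟩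
    have h0 : (0 : A) ∈ F := by
      refine hext.2 S.cone.zero_mem (S.cone.smul_mem (zero_le_two (α := ℝ)) (hext.1 hz)) hz
        ⟨1 / 2, 1 / 2, by norm_num, by norm_num, by norm_num, ?_⟩
      rw [smul_zero, zero_add, smul_smul]
      norm_num
    have hsmul : ∀ x ∈ F, ∀ a : ℝ, 0 ≤ a → a • x ∈ F := by
      intro x hx a ha
      rcases le_or_gt a 1 with h1 | h1
      · simpa using hconv hx h0 ha (sub_nonneg.2 h1) (by ring)
      · have hp : 0 < a := by linarith
        refine hext.2 (S.cone.smul_mem ha (hext.1 hx)) S.cone.zero_mem hx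
          ⟨a⁻¹, 1 - a⁻¹, inv_pos.2 hp, sub_pos.2 (inv_lt_one_of_one_lt₀ h1), by ring, ?_⟩
        simp [smul_smul, hp.ne']
    refine ⟨⟨PointedCone.ofConeComb F ⟨z, hz⟩ ?_, ⟨hext.1, ?_⟩⟩, rfl⟩
    · intro x hx y hy a ha b hb
      have h := hsmul _ (hconv (hsmul x hx a ha) (hsmul y hy b hb)
        (by norm_num : (0 : ℝ) ≤ 1 / 2) (by norm_num : (0 : ℝ) ≤ 1 / 2) (by norm_num)) 2 (by norm_num)
      rw [smul_add, smul_smul, smul_smul] at h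
      simpa using h
    · intro x y a hx hy ha h
      have h2 : (2 : ℝ) • a • x ∈ F := by
        refine hext.2 (S.cone.smul_mem zero_le_two (S.cone.smul_mem ha.le hx))
          (S.cone.smul_mem zero_le_two hy) h
          ⟨1 / 2, 1 / 2, by norm_num, by norm_num, by norm_num, ?_⟩
        rw [smul_smul, smul_smul (1 / 2 : ℝ) 2 y]
        norm_num
      have h3 := hsmul _ h2 (2 * a)⁻¹ (by positivity)
      have h4 : (2 * a)⁻¹ * (2 * a) = 1 := inv_mul_cancel₀ (by positivity)
      rwa [smul_smul, smul_smul, mul_assoc, h4, one_smul] at h3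

/-- The face generated by a set of points: the smallest face that contains it. -/
def faceGenerated (S : ProbSystem A) (s : Set A) : S.Face :=
  ⟨S.cone ⊓ sInf {F : PointedCone ℝ A | F.IsFaceOf S.cone ∧ s ⊆ F},
    PointedCone.IsFaceOf.sInf _ fun _ hF => hF.1⟩

theorem cone_salient (S : ProbSystem A) {x : A} (hx : x ∈ S.cone) (hx' : -x ∈ S.cone) : x = 0 := by
  obtain ⟨s, hs, ω, hω, rfl⟩ := hx
  obtain ⟨t, ht, τ, hτ, h⟩ := hx'
  have h' := congrArg S.unit h
  simp only [map_neg, map_smul, S.unit_apply ω hω, S.unit_apply τ hτ, smul_eq_mul, mul_one] at h'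
  have : s = 0 := by linarith
  simp [this]

/-- The lattice of faces of `A_+`: the order is inclusion, the meet is the intersection and the join
is the smallest face that contains both faces. -/
instance (S : ProbSystem A) : Lattice S.Face where
  inf F G := ⟨F.1 ⊓ G.1, F.2.inf_left G.2⟩
  inf_le_left F G := show F.1 ⊓ G.1 ≤ F.1 from inf_le_left
  inf_le_right F G := show F.1 ⊓ G.1 ≤ G.1 from inf_le_right
  le_inf F G H h h' := show F.1 ≤ G.1 ⊓ H.1 from le_inf h h'
  sup F G := S.faceGenerated ((F.1 : Set A) ∪ G.1)
  le_sup_left F _ := show F.1 ≤ _ from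
    le_inf F.2.le (le_sInf fun _ hH _ hx => hH.2 (Or.inl hx))
  le_sup_right _ G := show G.1 ≤ _ from
    le_inf G.2.le (le_sInf fun _ hH _ hx => hH.2 (Or.inr hx))
  sup_le _ _ H h h' := show _ ≤ H.1 from
    inf_le_right.trans (sInf_le ⟨H.2, Set.union_subset h h'⟩)

/-- The largest face is `A_+`, the smallest one is `{0}`. -/
instance (S : ProbSystem A) : BoundedOrder S.Face where
  top := ⟨S.cone, PointedCone.IsFaceOf.refl _⟩
  le_top F := F.2.le
  bot := ⟨⊥, bot_le, fun {x y a} hx hy ha h => by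
    have h0 : a • x + y = 0 := by simpa using h
    have hax : a • x = 0 := S.cone_salient (S.cone.smul_mem ha.le hx)
      (by rw [neg_eq_of_add_eq_zero_right h0]; exact hy)
    simpa [ha.ne'] using hax⟩
  bot_le F := show (⊥ : PointedCone ℝ A) ≤ F.1 from bot_le

/-- `B` is a self-dualizing inner product which is invariant under all reversible
transformations.  Self-dualizing means that the internal dual cone
`{y | ∀ x ∈ A_+, 0 ≤ B x y}` is `A_+` itself. -/
structure IsInvariantSelfDualizing (S : ProbSystem A) (B : LinearMap.BilinForm ℝ A) : Prop where
  symm : ∀ x y, B x y = B y x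
  pos : ∀ x, x ≠ 0 → 0 < B x x
  selfDual : {y : A | ∀ x ∈ S.cone, 0 ≤ B x y} = (S.cone : Set A)
  invariant : ∀ T, S.IsReversible T → ∀ x y, B (T x) (T y) = B x y

end ProbSystem

/-- The map `c` is an orthocomplementation of the bounded lattice `L`, and `L` is an orthomodular
lattice with respect to it. -/
structure IsOrthomodularLattice (L : Type*) [Lattice L] [BoundedOrder L] (c : L → L) : Prop where
  compl_compl : ∀ a, c (c a) = a
  compl_le_compl : ∀ a b, a ≤ b → c b ≤ c a
  inf_compl : ∀ a, a ⊓ c a = ⊥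
  sup_compl : ∀ a, a ⊔ c a = ⊤
  orthomodular : ∀ a b, a ≤ b → b = a ⊔ (b ⊓ c a)

namespace ProbSystem

variable {A : Type*} [NormedAddCommGroup A] [NormedSpace ℝ A] {S : ProbSystem A}

theorem mem_cone_of_mem_states {ω : A} (hω : ω ∈ S.states) : ω ∈ S.cone :=
  ⟨1, zero_le_one, ω, hω, by simp⟩

theorem effects_nonneg_of_mem_cone {e : StrongDual ℝ A} (he : e ∈ S.effects) {x : A}
    (hx : x ∈ S.cone) : 0 ≤ e x := by
  obtain ⟨t, ht, ω, hω, rfl⟩ := hx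
  simpa using mul_nonneg ht (S.effects_bounds e he ω hω).1

variable (S) in
theorem linearMap_ext_of_states {F : Type*} [AddCommGroup F] [Module ℝ F] {f g : A →ₗ[ℝ] F}
    (h : ∀ ω ∈ S.states, f ω = g ω) : f = g :=
  LinearMap.ext_on S.states_span h

theorem IsReversible.exists_inverse {T : A →L[ℝ] A} (hT : S.IsReversible T) :
    ∃ T', S.IsReversible T' ∧ (∀ x, T' (T x) = x) ∧ ∀ x, T (T' x) = x := by
  obtain ⟨hT, T', hT', h, h'⟩ := hT
  exact ⟨T', ⟨hT', T, hT, h', h⟩, fun x => DFunLike.congr_fun h x, fun x => DFunLike.congr_fun h' x⟩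

theorem IsReversible.map_states {T : A →L[ℝ] A} (hT : S.IsReversible T) {ω : A}
    (hω : ω ∈ S.states) : T ω ∈ S.states := by
  obtain ⟨T', hT', h, -⟩ := hT.exists_inverse
  obtain ⟨t, ht, τ, hτ, e⟩ := S.transformations_pos T hT.1 ω hω
  have h1 := S.transformations_unit_le T hT.1 ω hω
  have h2 := S.transformations_unit_le T' hT'.1 τ hτ
  have h3 : S.unit (T' (T ω)) = 1 := by rw [h, S.unit_apply ω hω]
  rw [e, map_smul, S.unit_apply τ hτ, smul_eq_mul, mul_one] at h1
  rw [e, map_smul, map_smul, smul_eq_mul] at h3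
  have ht1 : t = 1 := by nlinarith
  rwa [e, ht1, one_smul]

theorem IsReversible.unit_apply {T : A →L[ℝ] A} (hT : S.IsReversible T) (x : A) :
    S.unit (T x) = S.unit x := by
  have : (S.unit.comp T : A →L[ℝ] ℝ).toLinearMap = S.unit.toLinearMap :=
    S.linearMap_ext_of_states fun ω hω => by
      simp [S.unit_apply ω hω, S.unit_apply _ (hT.map_states hω)]
  exact DFunLike.congr_fun this x

theorem IsReversible.map_cone {T : A →L[ℝ] A} (hT : S.IsReversible T) {x : A}
    (hx : x ∈ S.cone) : T x ∈ S.cone := by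
  obtain ⟨t, ht, ω, hω, rfl⟩ := hx
  exact ⟨t, ht, T ω, hT.map_states hω, by simp⟩

theorem IsReversible.map_extremePoints {T : A →L[ℝ] A} (hT : S.IsReversible T) {ω : A}
    (hω : ω ∈ S.states.extremePoints ℝ) : T ω ∈ S.states.extremePoints ℝ := by
  obtain ⟨T', hT', h, h'⟩ := hT.exists_inverse
  refine ⟨hT.map_states hω.1, ?_⟩
  rintro x hx y hy ⟨a, b, ha, hb, hab, e⟩
  have := hω.2 (hT'.map_states hx) (hT'.map_states hy)
    ⟨a, b, ha, hb, hab, by rw [← h ω, ← e]; simp⟩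
  rw [← this, h']

theorem IsFrame.map {n : ℕ} {φ : Fin n → A} (hφ : S.IsFrame φ) {T : A →L[ℝ] A}
    (hT : S.IsReversible T) : S.IsFrame fun i => T (φ i) := by
  obtain ⟨T', hT', h, h'⟩ := hT.exists_inverse
  obtain ⟨hp, e, he, hle, hd⟩ := hφ
  refine ⟨fun i => hT.map_extremePoints (hp i), fun i => (e i).comp T',
    fun i => S.transformations_effects T' hT'.1 _ (he i), fun x hx => ?_, fun i j => ?_⟩
  · rw [← hT'.unit_apply]
    exact hle _ (hT'.map_cone hx)
  · simp [h, hd]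

theorem IsFrame.comp {n m : ℕ} {φ : Fin n → A} (hφ : S.IsFrame φ) {σ : Fin m → Fin n}
    (hσ : Function.Injective σ) : S.IsFrame (φ ∘ σ) := by
  obtain ⟨hp, e, he, hle, hd⟩ := hφ
  refine ⟨fun i => hp _, e ∘ σ, fun i => he _, fun x hx => ?_, fun i j => ?_⟩
  · refine le_trans ?_ (hle x hx)
    refine (Finset.sum_map Finset.univ ⟨σ, hσ⟩ fun i => e i x).symm.trans_le ?_
    exact Finset.sum_le_sum_of_subset_of_nonneg (Finset.subset_univ _)
      fun i _ _ => effects_nonneg_of_mem_cone (he i) hx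
  · simp [hd, hσ.eq_iff]

theorem IsFrame.linearIndependent {n : ℕ} {φ : Fin n → A} (hφ : S.IsFrame φ) :
    LinearIndependent ℝ φ := by
  obtain ⟨hp, e, he, hle, hd⟩ := hφ
  rw [Fintype.linearIndependent_iff]
  intro g hg i
  simpa [hd] using congrArg (e i) hg

theorem isFrame_const {ω : A} (hω : ω ∈ S.states.extremePoints ℝ) :
    S.IsFrame fun _ : Fin 1 => ω := by
  refine ⟨fun _ => hω, fun _ => S.unit, fun _ => S.unit_mem, fun x _ => by simp, fun i j => ?_⟩
  simp [S.unit_apply ω hω.1, Subsingleton.elim i j]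

theorem StrongSymmetry.exists_map_eq (h2 : S.StrongSymmetry) {ω φ : A}
    (hω : ω ∈ S.states.extremePoints ℝ) (hφ : φ ∈ S.states.extremePoints ℝ) :
    ∃ T : A →L[ℝ] A, S.IsReversible T ∧ T ω = φ := by
  obtain ⟨T, hT, h⟩ := h2 1 _ _ (isFrame_const hω) (isFrame_const hφ)
  exact ⟨T, hT, h 0⟩

theorem ClassicalDecomposability.exists_extremePoint (h1 : S.ClassicalDecomposability) :
    ∃ ω, ω ∈ S.states.extremePoints ℝ := by
  obtain ⟨ω, hω⟩ := S.states_nonempty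
  obtain ⟨n, φ, p, hφ, hp, hs, -⟩ := h1 ω hω
  rcases n with _ | n
  · simp at hs
  · exact ⟨φ 0, hφ.1 0⟩

variable (S) in
/-- The maximal size of a frame. -/
noncomputable def rank : ℕ := sSup {n | ∃ φ : Fin n → A, S.IsFrame φ}

section FiniteDimensional

variable [FiniteDimensional ℝ A]

variable (S) in
theorem bddAbove_frame_size : BddAbove {n | ∃ φ : Fin n → A, S.IsFrame φ} := by
  refine ⟨Module.finrank ℝ A, ?_⟩
  rintro n ⟨φ, hφ⟩
  simpa using hφ.linearIndependent.fintype_card_le_finrank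

theorem IsFrame.le_rank {n : ℕ} {φ : Fin n → A} (hφ : S.IsFrame φ) : n ≤ S.rank :=
  le_csSup S.bddAbove_frame_size ⟨φ, hφ⟩

variable (S) in
theorem exists_isFrame_rank : ∃ φ : Fin S.rank → A, S.IsFrame φ :=
  Nat.sSup_mem (s := {n | ∃ φ : Fin n → A, S.IsFrame φ})
    ⟨0, Fin.elim0, fun i => i.elim0, fun i => i.elim0, fun i => i.elim0,
      fun x hx => by simpa using effects_nonneg_of_mem_cone S.unit_mem hx, fun i => i.elim0⟩
    S.bddAbove_frame_size

theorem IsFrame.exists_extension (h2 : S.StrongSymmetry) {n : ℕ} {φ : Fin n → A}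
    (hφ : S.IsFrame φ) :
    ∃ ψ : Fin S.rank → A, S.IsFrame ψ ∧ ∀ i, ψ (Fin.castLE hφ.le_rank i) = φ i := by
  obtain ⟨χ, hχ⟩ := S.exists_isFrame_rank
  obtain ⟨T, hT, h⟩ := h2 n _ φ (hχ.comp (Fin.castLE_injective hφ.le_rank)) hφ
  exact ⟨_, hχ.map hT, h⟩

theorem exists_isFrame_apply_eq (h2 : S.StrongSymmetry) {ω : A}
    (hω : ω ∈ S.states.extremePoints ℝ) :
    ∃ ψ : Fin S.rank → A, S.IsFrame ψ ∧ ∃ i, ψ i = ω := by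
  obtain ⟨ψ, hψ, h⟩ := (isFrame_const hω).exists_extension h2
  exact ⟨ψ, hψ, _, h 0⟩

theorem rank_pos (h1 : S.ClassicalDecomposability) : 0 < S.rank := by
  obtain ⟨ω, hω⟩ := h1.exists_extremePoint
  exact (isFrame_const hω).le_rank

/-- Every state is a mixture of a frame of maximal size. -/
theorem exists_decomposition_rank (h1 : S.ClassicalDecomposability) (h2 : S.StrongSymmetry)
    {ω : A} (hω : ω ∈ S.states) :
    ∃ (φ : Fin S.rank → A) (p : Fin S.rank → ℝ), S.IsFrame φ ∧ (∀ i, 0 ≤ p i) ∧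
      ω = ∑ i, p i • φ i := by
  obtain ⟨n, φ, p, hφ, hp, -, e⟩ := h1 ω hω
  obtain ⟨ψ, hψ, h⟩ := hφ.exists_extension h2
  have hinj := Fin.castLE_injective hφ.le_rank
  refine ⟨ψ, Function.extend (Fin.castLE hφ.le_rank) p 0, hψ, fun i => ?_, ?_⟩
  · by_cases hi : ∃ j, Fin.castLE hφ.le_rank j = i
    · obtain ⟨j, rfl⟩ := hi
      rw [hinj.extend_apply]
      exact hp j
    · rw [Function.extend_apply' _ _ _ hi]
      simp
  · rw [e]
    refine Finset.sum_of_injOn (Fin.castLE hφ.le_rank) hinj.injOn 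
      (fun _ _ => Finset.mem_coe.2 (Finset.mem_univ _)) (fun i _ hi => ?_) fun i _ => ?_
    · rw [Function.extend_apply' _ _ _ fun ⟨j, hj⟩ => hi ⟨j, by simp, hj⟩]
      simp
    · rw [hinj.extend_apply, h]

end FiniteDimensional

end ProbSystem

namespace ProbSystem

variable {A : Type*} [NormedAddCommGroup A] [NormedSpace ℝ A] {S : ProbSystem A}

theorem StrongSymmetry.id_mem (h2 : S.StrongSymmetry) :
    ContinuousLinearMap.id ℝ A ∈ S.transformations := by
  have h0 : S.IsFrame (Fin.elim0 : Fin 0 → A) :=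
    ⟨fun i => i.elim0, fun i => i.elim0, fun i => i.elim0,
      fun x hx => by simpa using effects_nonneg_of_mem_cone S.unit_mem hx, fun i => i.elim0⟩
  obtain ⟨T, ⟨hT, T', hT', h, -⟩, -⟩ := h2 0 _ _ h0 h0
  rw [← h]
  exact S.transformations_comp _ hT' _ hT

/-- The group of reversible transformations. -/
def reversibleGroup (S : ProbSystem A) (h2 : S.StrongSymmetry) : Subgroup (A →L[ℝ] A)ˣ where
  carrier := {g | (g : A →L[ℝ] A) ∈ S.transformations ∧
    ((g⁻¹ : (A →L[ℝ] A)ˣ) : A →L[ℝ] A) ∈ S.transformations}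
  mul_mem' {g h} hg hh := ⟨S.transformations_comp _ hg.1 _ hh.1, by
    rw [mul_inv_rev]
    exact S.transformations_comp _ hh.2 _ hg.2⟩
  one_mem' := ⟨h2.id_mem, by
    rw [inv_one]
    exact h2.id_mem⟩
  inv_mem' {g} hg := ⟨hg.2, by simpa using hg.1⟩

theorem IsReversible.exists_mem_reversibleGroup (h2 : S.StrongSymmetry) {T : A →L[ℝ] A}
    (hT : S.IsReversible T) : ∃ g ∈ S.reversibleGroup h2, (g : A →L[ℝ] A) = T := by
  obtain ⟨hT, T', hT', h, h'⟩ := hT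
  exact ⟨⟨T, T', h', h⟩, ⟨hT, hT'⟩, rfl⟩

variable [FiniteDimensional ℝ A]

variable (S) in
theorem isCompact_transformations : IsCompact S.transformations := by
  have := FiniteDimensional.complete ℝ A
  have := FiniteDimensional.proper ℝ (A →L[ℝ] A)
  refine Metric.isCompact_of_isClosed_isBounded S.transformations_closed ?_
  obtain ⟨C, hC⟩ := S.states_compact.isBounded.exists_norm_le
  have key : ∀ x : A, ∃ K, ∀ T : S.transformations, ‖T.1 x‖ ≤ K := by
    intro x
    have hx : x ∈ Submodule.span ℝ S.states := by simp [S.states_span]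
    induction hx using Submodule.span_induction with
    | mem ω hω =>
      refine ⟨C, fun T => ?_⟩
      obtain ⟨t, ht, τ, hτ, e⟩ := S.transformations_pos T T.2 ω hω
      have h1 := S.transformations_unit_le T T.2 ω hω
      rw [e, map_smul, S.unit_apply τ hτ, smul_eq_mul, mul_one] at h1
      rw [e, norm_smul, Real.norm_of_nonneg ht]
      exact (mul_le_of_le_one_left (norm_nonneg _) h1).trans (hC τ hτ)
    | zero => exact ⟨0, fun T => by simp⟩
    | add x y _ _ hx hy =>
      obtain ⟨K, hK⟩ := hx
      obtain ⟨L, hL⟩ := hy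
      refine ⟨K + L, fun T => ?_⟩
      rw [map_add]
      exact (norm_add_le _ _).trans (add_le_add (hK T) (hL T))
    | smul a x _ hx =>
      obtain ⟨K, hK⟩ := hx
      refine ⟨‖a‖ * K, fun T => ?_⟩
      rw [map_smul, norm_smul]
      exact mul_le_mul_of_nonneg_left (hK T) (norm_nonneg _)
  obtain ⟨K, hK⟩ := banach_steinhaus key
  exact isBounded_iff_forall_norm_le.2 ⟨K, fun T hT => hK ⟨T, hT⟩⟩

theorem isCompact_reversibleGroup (h2 : S.StrongSymmetry) :
    IsCompact (S.reversibleGroup h2 : Set (A →L[ℝ] A)ˣ) := by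
  have h := S.isCompact_transformations
  convert Units.isClosedEmbedding_embedProduct.isCompact_preimage
    (h.prod (h.image MulOpposite.continuous_op)) using 1
  ext g
  simp [reversibleGroup]

open MeasureTheory in
/-- There is an inner product that is invariant under all reversible transformations. -/
theorem exists_invariant_form (h2 : S.StrongSymmetry) : ∃ B : LinearMap.BilinForm ℝ A,
    (∀ x y, B x y = B y x) ∧ (∀ x, x ≠ 0 → 0 < B x x) ∧
      ∀ T, S.IsReversible T → ∀ x y, B (T x) (T y) = B x y := by
  have : CompactSpace (S.reversibleGroup h2) :=
    isCompact_iff_compactSpace.1 (isCompact_reversibleGroup h2)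
  let : MeasurableSpace (S.reversibleGroup h2) := borel _
  have : BorelSpace (S.reversibleGroup h2) := ⟨rfl⟩
  let act : S.reversibleGroup h2 → A → A := fun g x => (g⁻¹).1.1 x
  let f : A → A → S.reversibleGroup h2 → ℝ := fun x y g =>
    inner ℝ (toEuclidean (act g x)) (toEuclidean (act g y))
  have hact : ∀ x, Continuous fun g => act g x := fun x => by
    have : Continuous fun g : S.reversibleGroup h2 => ((g⁻¹).1.1 : A →L[ℝ] A) :=
      Units.continuous_val.comp (continuous_subtype_val.comp continuous_inv)
    exact this.clm_apply continuous_const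
  have hf : ∀ x y, Continuous (f x y) := fun x y =>
    (toEuclidean.continuous.comp (hact x)).inner (toEuclidean.continuous.comp (hact y))
  have hi : ∀ x y, Integrable (f x y) Measure.haar := fun x y =>
    (hf x y).integrable_of_hasCompactSupport (HasCompactSupport.of_compactSpace _)
  let B : LinearMap.BilinForm ℝ A := LinearMap.mk₂ ℝ (fun x y => ∫ g, f x y g ∂Measure.haar)
    (fun x x' y => by
      rw [← integral_add (hi _ _) (hi _ _)]
      simp [f, act, inner_add_left])
    (fun c x y => by
      rw [smul_eq_mul, ← integral_const_mul]
      simp [f, act, inner_smul_left])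
    (fun x y y' => by
      rw [← integral_add (hi _ _) (hi _ _)]
      simp [f, act, inner_add_right])
    (fun c x y => by
      rw [smul_eq_mul, ← integral_const_mul]
      simp [f, act, inner_smul_right])
  refine ⟨B, fun x y => ?_, fun x hx => ?_, fun T hT x y => ?_⟩
  · simp only [B, LinearMap.mk₂_apply, f]
    simp_rw [real_inner_comm]
  · simp only [B, LinearMap.mk₂_apply]
    refine (hf x x).integral_pos_of_hasCompactSupport_nonneg_nonzero
      (HasCompactSupport.of_compactSpace _) (fun g => real_inner_self_nonneg) (x := 1) ?_
    simpa [f, act] using hx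
  · obtain ⟨g, hg, rfl⟩ := hT.exists_mem_reversibleGroup h2
    have : ∀ z h, act h ((g : A →L[ℝ] A) z) = act ((⟨g, hg⟩ : S.reversibleGroup h2)⁻¹ * h) z := by
      intro z h
      simp [act]
    simp only [B, LinearMap.mk₂_apply]
    rw [← integral_mul_left_eq_self (f x y) (⟨g, hg⟩ : S.reversibleGroup h2)⁻¹]
    simp only [f, this]

end ProbSystem

namespace ProbSystem

variable {A : Type*} [NormedAddCommGroup A] [NormedSpace ℝ A] {S : ProbSystem A}

/-- A functional that is constant on the pure states is a multiple of the unit functional. -/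
theorem apply_eq_mul_unit_of_extremePoints (h1 : S.ClassicalDecomposability) {f : A →ₗ[ℝ] ℝ}
    {k : ℝ} (hf : ∀ ω ∈ S.states.extremePoints ℝ, f ω = k) (x : A) : f x = k * S.unit x := by
  have : f = k • S.unit.toLinearMap := S.linearMap_ext_of_states fun ω hω => by
    obtain ⟨n, φ, p, hφ, -, hs, rfl⟩ := h1 ω hω
    simp [hf _ (hφ.1 _), S.unit_apply _ (hφ.1 _).1, ← Finset.sum_mul, hs]
  simp [this]

theorem IsFrame.sum_smul_mem_cone {n : ℕ} {φ : Fin n → A} (hφ : S.IsFrame φ) {r : Fin n → ℝ}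
    (hr : ∀ i, 0 ≤ r i) : ∑ i, r i • φ i ∈ S.cone :=
  sum_mem fun i _ => S.cone.smul_mem (hr i) (mem_cone_of_mem_states (hφ.1 i).1)

variable [FiniteDimensional ℝ A]

theorem continuous_bilinForm_self (B : LinearMap.BilinForm ℝ A) : Continuous fun x => B x x := by
  let f : A →ₗ[ℝ] A →L[ℝ] ℝ := LinearMap.toContinuousLinearMap.toLinearMap ∘ₗ B
  exact f.continuous_of_finiteDimensional.clm_apply continuous_id

/-- There is a state that is invariant under all reversible transformations. -/
theorem exists_invariant_state (h2 : S.StrongSymmetry) :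
    ∃ μ ∈ S.states, ∀ T, S.IsReversible T → T μ = μ := by
  obtain ⟨B, hs, hp, hB⟩ := exists_invariant_form h2
  obtain ⟨μ, hμ, hmin⟩ := S.states_compact.exists_isMinOn S.states_nonempty
    (continuous_bilinForm_self B).continuousOn
  refine ⟨μ, hμ, fun T hT => ?_⟩
  have hTμ := hT.map_states hμ
  have h := hmin (S.states_convex hμ hTμ (by norm_num : (0 : ℝ) ≤ 1 / 2)
    (by norm_num : (0 : ℝ) ≤ 1 / 2) (by norm_num))
  by_contra hne
  have h' := hp _ (sub_ne_zero.2 hne)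
  simp only [Set.mem_ofPred_eq, map_add, map_smul, map_sub, LinearMap.add_apply,
    LinearMap.sub_apply, LinearMap.smul_apply, smul_eq_mul, hB T hT, hs (T μ) μ] at h h'
  linarith

/-- All frames of maximal size have the same sum. -/
theorem exists_center (h1 : S.ClassicalDecomposability) (h2 : S.StrongSymmetry) :
    ∃ ν : A, ∀ φ : Fin S.rank → A, S.IsFrame φ → ∑ i, φ i = ν := by
  obtain ⟨μ, hμ, hinv⟩ := exists_invariant_state h2
  obtain ⟨φ, p, hφ, -, e⟩ := exists_decomposition_rank h1 h2 hμ
  have hp : ∀ i j, p i = p j := by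
    intro i j
    obtain ⟨T, hT, h⟩ := h2 _ φ _ hφ (hφ.comp (Equiv.swap i j).injective)
    have h3 := hinv T hT
    rw [e, map_sum] at h3
    simp only [map_smul, h, Function.comp_apply] at h3
    rw [← Equiv.sum_comp (Equiv.swap i j)] at h3
    simp only [Equiv.swap_apply_self] at h3
    have h4 := hφ.linearIndependent
    rw [Fintype.linearIndependent_iffₛ] at h4
    simpa using h4 _ _ h3 i |>.symm
  have hsum : ∑ i, p i = 1 := by
    have := congrArg S.unit e
    simpa [S.unit_apply μ hμ, S.unit_apply _ (hφ.1 _).1] using this.symm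
  have hp' : ∀ i, (S.rank : ℝ) * p i = 1 := fun i => by
    rw [← hsum, Finset.sum_congr rfl fun j _ => hp j i]
    simp
  have hsumφ : ∑ i, φ i = (S.rank : ℝ) • μ := by
    rw [e, Finset.smul_sum]
    exact Finset.sum_congr rfl fun i _ => by rw [smul_smul, hp', one_smul]
  refine ⟨(S.rank : ℝ) • μ, fun ψ hψ => ?_⟩
  obtain ⟨T, hT, h⟩ := h2 _ φ ψ hφ hψ
  rw [← Finset.sum_congr rfl fun i _ => h i, ← map_sum, hsumφ, map_smul, hinv T hT]

theorem exists_decomposition_of_mem_cone (h1 : S.ClassicalDecomposability)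
    (h2 : S.StrongSymmetry) {x : A} (hx : x ∈ S.cone) :
    ∃ (φ : Fin S.rank → A) (r : Fin S.rank → ℝ), S.IsFrame φ ∧ (∀ i, 0 ≤ r i) ∧
      x = ∑ i, r i • φ i := by
  obtain ⟨t, ht, ω, hω, rfl⟩ := hx
  obtain ⟨φ, p, hφ, hp, rfl⟩ := exists_decomposition_rank h1 h2 hω
  exact ⟨φ, fun i => t * p i, hφ, fun i => mul_nonneg ht (hp i), by
    simp [Finset.smul_sum, smul_smul]⟩

/-- Every vector is a linear combination of a frame of maximal size. -/
theorem exists_decomposition (h1 : S.ClassicalDecomposability) (h2 : S.StrongSymmetry) (x : A) :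
    ∃ (φ : Fin S.rank → A) (r : Fin S.rank → ℝ), S.IsFrame φ ∧ x = ∑ i, r i • φ i := by
  obtain ⟨ν, hν⟩ := exists_center h1 h2
  have hpure : ∀ ω ∈ S.states.extremePoints ℝ, ν - ω ∈ S.cone := by
    intro ω hω
    obtain ⟨ψ, hψ, i, rfl⟩ := exists_isFrame_apply_eq h2 hω
    rw [← hν ψ hψ, ← Finset.sum_erase_eq_sub (Finset.mem_univ i)]
    exact sum_mem fun j _ => mem_cone_of_mem_states (hψ.1 j).1
  have hν0 : ν ∈ S.cone := by
    obtain ⟨ψ, hψ⟩ := S.exists_isFrame_rank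
    rw [← hν ψ hψ]
    exact sum_mem fun j _ => mem_cone_of_mem_states (hψ.1 j).1
  have key : ∀ x : A, ∃ s : ℝ, s • ν + x ∈ S.cone ∧ s • ν - x ∈ S.cone := by
    intro x
    have hx : x ∈ Submodule.span ℝ S.states := by simp [S.states_span]
    induction hx using Submodule.span_induction with
    | mem ω hω =>
      obtain ⟨n, φ, p, hφ, hp, hs, rfl⟩ := h1 ω hω
      refine ⟨1, ?_, ?_⟩
      · rw [one_smul]
        exact add_mem hν0 (hφ.sum_smul_mem_cone hp)
      · rw [← hs, Finset.sum_smul, ← Finset.sum_sub_distrib]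
        refine sum_mem fun i _ => ?_
        rw [← smul_sub]
        exact S.cone.smul_mem (hp i) (hpure _ (hφ.1 i))
    | zero => exact ⟨0, by simp, by simp⟩
    | add x y _ _ hx hy =>
      obtain ⟨s, hs, hs'⟩ := hx
      obtain ⟨t, ht, ht'⟩ := hy
      refine ⟨s + t, ?_, ?_⟩
      · convert add_mem hs ht using 1
        module
      · convert add_mem hs' ht' using 1
        module
    | smul a x _ hx =>
      obtain ⟨s, hs, hs'⟩ := hx
      rcases le_total 0 a with ha | ha
      · refine ⟨a * s, ?_, ?_⟩
        · convert S.cone.smul_mem ha hs using 1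
          module
        · convert S.cone.smul_mem ha hs' using 1
          module
      · refine ⟨-a * s, ?_, ?_⟩
        · convert S.cone.smul_mem (neg_nonneg.2 ha) hs' using 1
          module
        · convert S.cone.smul_mem (neg_nonneg.2 ha) hs using 1
          module
  obtain ⟨s, hs, -⟩ := key x
  obtain ⟨φ, r, hφ, -, e⟩ := exists_decomposition_of_mem_cone h1 h2 hs
  refine ⟨φ, fun i => r i - s, hφ, ?_⟩
  simp only [sub_smul, Finset.sum_sub_distrib, ← Finset.smul_sum, hν φ hφ, ← e]
  abel

end ProbSystem

namespace ProbSystem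

variable {A : Type*} [NormedAddCommGroup A] [NormedSpace ℝ A] {S : ProbSystem A}

theorem exists_dual_vector [FiniteDimensional ℝ A] {B : LinearMap.BilinForm ℝ A}
    (hpos : ∀ x, x ≠ 0 → 0 < B x x) (f : A →ₗ[ℝ] ℝ) : ∃ v, ∀ x, B v x = f x := by
  have hinj : Function.Injective B := by
    refine (injective_iff_map_eq_zero B).2 fun x hx => ?_
    by_contra h
    simpa [hx] using hpos x h
  have hsurj : Function.Surjective B :=
    (LinearMap.injective_iff_surjective_of_finrank_eq_finrank
      (Subspace.dual_finrank_eq (K := ℝ) (V := A)).symm).1 hinj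
  obtain ⟨v, rfl⟩ := hsurj f
  exact ⟨v, fun _ => rfl⟩

/-- `B` is an inner product with respect to which all frames are orthonormal. -/
structure IsFrameForm (S : ProbSystem A) (B : LinearMap.BilinForm ℝ A) : Prop where
  symm : ∀ x y, B x y = B y x
  pos : ∀ x, x ≠ 0 → 0 < B x x
  frame : ∀ {n : ℕ} {φ : Fin n → A}, S.IsFrame φ → ∀ i j, B (φ i) (φ j) = if i = j then 1 else 0

namespace IsFrameForm

variable {B : LinearMap.BilinForm ℝ A}

theorem eq_zero (hB : S.IsFrameForm B) {x : A} (hx : B x x = 0) : x = 0 := by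
  by_contra h
  exact (hB.pos x h).ne' hx

theorem self_apply (hB : S.IsFrameForm B) {ω : A} (hω : ω ∈ S.states.extremePoints ℝ) :
    B ω ω = 1 := by
  simpa using hB.frame (isFrame_const hω) 0 0

theorem sum_smul_apply (hB : S.IsFrameForm B) {n : ℕ} {φ : Fin n → A} (hφ : S.IsFrame φ)
    (r : Fin n → ℝ) (j : Fin n) : B (∑ i, r i • φ i) (φ j) = r j := by
  simp [hB.frame hφ]

theorem apply_le_one (hB : S.IsFrameForm B) {ω φ : A} (hω : ω ∈ S.states.extremePoints ℝ)
    (hφ : φ ∈ S.states.extremePoints ℝ) : B ω φ ≤ 1 := by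
  rcases eq_or_ne ω φ with rfl | h
  · exact (hB.self_apply hω).le
  · have := hB.pos _ (sub_ne_zero.2 h)
    simp only [map_sub, LinearMap.sub_apply, hB.self_apply hω, hB.self_apply hφ, hB.symm φ ω]
      at this
    linarith

theorem eq_of_apply_eq_one (hB : S.IsFrameForm B) {ω φ : A} (hω : ω ∈ S.states.extremePoints ℝ)
    (hφ : φ ∈ S.states.extremePoints ℝ) (h : B ω φ = 1) : ω = φ := by
  refine sub_eq_zero.1 (hB.eq_zero ?_)
  simp [hB.self_apply hω, hB.self_apply hφ, hB.symm φ ω, h]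

variable [FiniteDimensional ℝ A]

theorem sum_apply (hB : S.IsFrameForm B) (h1 : S.ClassicalDecomposability)
    (h2 : S.StrongSymmetry) {φ : Fin S.rank → A} (hφ : S.IsFrame φ) (x : A) :
    ∑ i, B (φ i) x = S.unit x := by
  obtain ⟨ν, hν⟩ := exists_center h1 h2
  have key : B (∑ i, φ i) x = 1 * S.unit x := by
    refine apply_eq_mul_unit_of_extremePoints h1 (fun ω hω => ?_) x
    obtain ⟨ψ, hψ, i, rfl⟩ := exists_isFrame_apply_eq h2 hω
    rw [hν φ hφ, ← hν ψ hψ]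
    simp [hB.frame hψ]
  simpa using key

/-- The inner product with a pure state is an allowed effect. -/
theorem exists_effect (hB : S.IsFrameForm B) (h1 : S.ClassicalDecomposability)
    (h2 : S.StrongSymmetry) {ω : A} (hω : ω ∈ S.states.extremePoints ℝ) :
    ∃ e ∈ S.effects, ∀ x, e x = B ω x := by
  obtain ⟨ψ, hψ, k, rfl⟩ := exists_isFrame_apply_eq h2 hω
  obtain ⟨hp, e, he, hle, hd⟩ := id hψ
  obtain ⟨ν, hν⟩ := exists_center h1 h2
  obtain ⟨v, hv⟩ := exists_dual_vector hB.pos (e k).toLinearMap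
  obtain ⟨φ, r, hφ, rfl⟩ := exists_decomposition h1 h2 v
  have hr : ∀ j, 0 ≤ r j := fun j => by
    rw [← hB.sum_smul_apply hφ r j, hv]
    exact effects_nonneg_of_mem_cone (he k) (mem_cone_of_mem_states (hφ.1 j).1)
  have hsum : ∑ j, r j = 1 := by
    have h3 : B (∑ i, r i • φ i) ν = 1 := by
      rw [hv, ← hν ψ hψ]
      simp [hd]
    rw [← hν φ hφ, map_sum] at h3
    simpa only [hB.sum_smul_apply hφ] using h3
  have h4 : ∑ j, r j * (1 - B (φ j) (ψ k)) = 0 := by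
    have h3 : B (∑ i, r i • φ i) (ψ k) = 1 := by
      rw [hv]
      simp [hd]
    simp only [map_sum, map_smul, LinearMap.sum_apply, LinearMap.smul_apply, smul_eq_mul] at h3
    simp only [mul_sub, Finset.sum_sub_distrib, mul_one, h3, hsum, sub_self]
  rw [Finset.sum_eq_zero_iff_of_nonneg fun j _ =>
    mul_nonneg (hr j) (sub_nonneg.2 (hB.apply_le_one (hφ.1 j) (hp k)))] at h4
  have h5 : ∑ i, r i • φ i = ψ k := by
    rw [← one_smul ℝ (ψ k), ← hsum, Finset.sum_smul]
    refine Finset.sum_congr rfl fun j hj => ?_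
    rcases mul_eq_zero.1 (h4 j hj) with h | h
    · simp [h]
    · rw [hB.eq_of_apply_eq_one (hφ.1 j) (hp k) (sub_eq_zero.1 h).symm]
  rw [h5] at hv
  exact ⟨e k, he k, fun x => (hv x).symm⟩

theorem apply_nonneg (hB : S.IsFrameForm B) (h1 : S.ClassicalDecomposability)
    (h2 : S.StrongSymmetry) {x y : A} (hx : x ∈ S.cone) (hy : y ∈ S.cone) : 0 ≤ B x y := by
  obtain ⟨φ, r, hφ, hr, rfl⟩ := exists_decomposition_of_mem_cone h1 h2 hx
  simp only [map_sum, map_smul, LinearMap.sum_apply, LinearMap.smul_apply, smul_eq_mul]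
  refine Finset.sum_nonneg fun i _ => mul_nonneg (hr i) ?_
  obtain ⟨e, he, h⟩ := hB.exists_effect h1 h2 (hφ.1 i)
  rw [← h]
  exact effects_nonneg_of_mem_cone he hy

theorem selfDual (hB : S.IsFrameForm B) (h1 : S.ClassicalDecomposability)
    (h2 : S.StrongSymmetry) : {y : A | ∀ x ∈ S.cone, 0 ≤ B x y} = (S.cone : Set A) := by
  ext y
  refine ⟨fun hy => ?_, fun hy x hx => hB.apply_nonneg h1 h2 hx hy⟩
  obtain ⟨φ, r, hφ, rfl⟩ := exists_decomposition h1 h2 y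
  refine hφ.sum_smul_mem_cone fun i => ?_
  rw [← hB.sum_smul_apply hφ r i, hB.symm]
  exact hy _ (mem_cone_of_mem_states (hφ.1 i).1)

/-- Mutually orthogonal pure states form a frame. -/
theorem isFrame_of_orthogonal (hB : S.IsFrameForm B) (h1 : S.ClassicalDecomposability)
    (h2 : S.StrongSymmetry) {n : ℕ} {φ : Fin n → A}
    (hφ : ∀ i, φ i ∈ S.states.extremePoints ℝ) (ho : ∀ i j, i ≠ j → B (φ i) (φ j) = 0) :
    S.IsFrame φ := by
  choose E hE hEφ using fun i => hB.exists_effect h1 h2 (hφ i)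
  suffices h : S.IsFrame φ ∧ ∑ i, E i ∈ S.effects from h.1
  have hzero : (0 : StrongDual ℝ A) ∈ S.effects := by
    simpa using S.unit_sub_mem _ S.unit_mem
  induction n with
  | zero =>
    refine ⟨⟨fun i => i.elim0, fun i => i.elim0, fun i => i.elim0,
      fun x hx => by simpa using effects_nonneg_of_mem_cone S.unit_mem hx, fun i => i.elim0⟩, ?_⟩
    simpa using hzero
  | succ n ih =>
    obtain ⟨ih1, ih2⟩ := ih (φ := fun i => φ i.succ) (fun i => hφ _)
      (fun i j hij => ho _ _ (by simpa using hij)) (fun i => E i.succ) (fun i => hE _)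
      (fun i => hEφ _)
    have hone : ∀ i, S.unit (φ i) = 1 := fun i => S.unit_apply _ (hφ i).1
    have hd : ∀ i j, E i (φ j) = if i = j then 1 else 0 := fun i j => by
      rw [hEφ]
      split_ifs with h
      · rw [h, hB.self_apply (hφ j)]
      · exact ho i j h
    have hF : S.IsFrame φ := by
      refine ⟨hφ, Fin.cons (S.unit - ∑ i : Fin n, E i.succ) fun i => E i.succ,
        fun i => ?_, fun x hx => ?_, Fin.cases (fun j => ?_) fun i j => ?_⟩
      · refine Fin.cases ?_ (fun i => ?_) i
        · simpa using S.unit_sub_mem _ ih2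
        · simpa using hE _
      · simp [Fin.sum_univ_succ]
      · refine Fin.cases ?_ (fun j => ?_) j
        · simp [hone, hd]
        · simp [hone, hd, (Fin.succ_ne_zero j).symm]
      · simp [hd]
    refine ⟨hF, ?_⟩
    rw [Fin.sum_univ_succ]
    refine S.effects_add _ (hE 0) _ ih2 fun ω hω => ?_
    obtain ⟨ψ, hψ, h⟩ := hF.exists_extension h2
    have h3 := hB.sum_apply h1 h2 hψ ω
    rw [S.unit_apply ω hω] at h3
    rw [← h3]
    have h4 : E 0 ω + (∑ i : Fin n, E i.succ) ω
        = ∑ i, B (ψ (Fin.castLE hF.le_rank i)) ω := by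
      simp only [h, ← hEφ]
      simp [Fin.sum_univ_succ]
    rw [h4]
    refine (Finset.sum_map Finset.univ ⟨_, Fin.castLE_injective hF.le_rank⟩
      fun i => B (ψ i) ω).symm.trans_le ?_
    exact Finset.sum_le_sum_of_subset_of_nonneg (Finset.subset_univ _) fun i _ _ =>
      hB.apply_nonneg h1 h2 (mem_cone_of_mem_states (hψ.1 i).1) (mem_cone_of_mem_states hω)

end IsFrameForm

variable [FiniteDimensional ℝ A]

/-- An invariant inner product takes a constant value on pure states and on pairs of
perfectly distinguishable pure states. -/
theorem exists_frame_values (h1 : S.ClassicalDecomposability) (h2 : S.StrongSymmetry)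
    {B : LinearMap.BilinForm ℝ A} (hpos : ∀ x, x ≠ 0 → 0 < B x x)
    (hinv : ∀ T, S.IsReversible T → ∀ x y, B (T x) (T y) = B x y) :
    ∃ k c : ℝ, 0 < k ∧ (S.rank = 1 → c = 0) ∧
      ∀ (n : ℕ) (φ : Fin n → A), S.IsFrame φ → ∀ i j, B (φ i) (φ j) = if i = j then k else c := by
  obtain ⟨ω, hω⟩ := h1.exists_extremePoint
  have hω0 : ω ≠ 0 := by
    rintro rfl
    simpa using S.unit_apply _ hω.1
  have hk : ∀ φ ∈ S.states.extremePoints ℝ, B φ φ = B ω ω := by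
    intro φ hφ
    obtain ⟨T, hT, rfl⟩ := h2.exists_map_eq hω hφ
    exact hinv T hT _ _
  by_cases h : ∃ ψ : Fin 2 → A, S.IsFrame ψ
  · obtain ⟨ψ, hψ⟩ := h
    refine ⟨B ω ω, B (ψ 0) (ψ 1), hpos _ hω0, fun h => ?_, fun n φ hφ i j => ?_⟩
    · have := hψ.le_rank
      omega
    · split_ifs with hij
      · rw [hij, hk _ (hφ.1 j)]
      · have hinj : Function.Injective ![i, j] := by
          intro a b
          fin_cases a <;> fin_cases b <;> simp [hij, Ne.symm hij]
        obtain ⟨T, hT, h⟩ := h2 2 _ _ hψ (hφ.comp hinj)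
        rw [← hinv T hT (ψ 0), h, h]
        simp
  · refine ⟨B ω ω, 0, hpos _ hω0, fun _ => rfl, fun n φ hφ i j => ?_⟩
    split_ifs with hij
    · rw [hij, hk _ (hφ.1 j)]
    · refine absurd ⟨_, hφ.comp (σ := ![i, j]) ?_⟩ h
      intro a b
      fin_cases a <;> fin_cases b <;> simp [hij, Ne.symm hij]

/-- There is an invariant inner product with respect to which all frames are orthonormal. -/
theorem exists_invariant_frameForm (h1 : S.ClassicalDecomposability) (h2 : S.StrongSymmetry) :
    ∃ B : LinearMap.BilinForm ℝ A, S.IsFrameForm B ∧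
      ∀ T, S.IsReversible T → ∀ x y, B (T x) (T y) = B x y := by
  obtain ⟨B, hsymm, hpos, hinv⟩ := exists_invariant_form h2
  obtain ⟨k, c, hk, hc, hB⟩ := exists_frame_values h1 h2 hpos hinv
  obtain ⟨φ, hφ⟩ := S.exists_isFrame_rank
  have hrank := rank_pos h1
  have hkc : 0 < k - c := by
    rcases Nat.lt_or_ge 1 S.rank with h | h
    · have h01 : (⟨0, hrank⟩ : Fin S.rank) ≠ ⟨1, h⟩ := by simp
      have h3 := hpos _ (sub_ne_zero.2 (hφ.linearIndependent.injective.ne h01))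
      simp only [map_sub, LinearMap.sub_apply, hB _ φ hφ, if_pos, if_neg h01, if_neg h01.symm] at h3
      linarith
    · rw [hc (by omega), sub_zero]
      exact hk
  let U : LinearMap.BilinForm ℝ A :=
    LinearMap.mk₂ ℝ (fun x y => S.unit x * S.unit y) (fun _ _ _ => by simp [add_mul])
      (fun _ _ _ => by simp [mul_assoc]) (fun _ _ _ => by simp [mul_add])
      (fun _ _ _ => by simp [mul_left_comm])
  have hU : ∀ x y, U x y = S.unit x * S.unit y := fun _ _ => rfl
  obtain ⟨ν, hν⟩ := exists_center h1 h2
  have hνinv : ∀ T, S.IsReversible T → T ν = ν := fun T hT => by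
    nth_rw 1 [← hν φ hφ]
    rw [map_sum, hν _ (hφ.map hT)]
  have hνU : S.unit ν = S.rank := by
    rw [← hν φ hφ]
    simp [S.unit_apply _ (hφ.1 _).1]
  have hνB : B ν ν = S.rank * (k + (S.rank - 1) * c) := by
    rw [← hν φ hφ]
    have : ∀ i j, B (φ i) (φ j) = (if i = j then k - c else 0) + c := fun i j => by
      rw [hB _ φ hφ]
      split_ifs <;> ring
    simp only [map_sum, LinearMap.sum_apply, this, Finset.sum_add_distrib]
    simp
    ring
  have hκ : ∀ x, B ν x = B ν (φ ⟨0, hrank⟩) * S.unit x := by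
    refine fun x => apply_eq_mul_unit_of_extremePoints h1 (f := B ν) (fun ω hω => ?_) x
    obtain ⟨T, hT, rfl⟩ := h2.exists_map_eq (hφ.1 ⟨0, hrank⟩) hω
    rw [← hinv T hT ν (φ _), hνinv T hT]
  refine ⟨(k - c)⁻¹ • (B - c • U), ⟨fun x y => ?_, fun x hx => ?_, fun {n ψ} hψ i j => ?_⟩,
    fun T hT x y => ?_⟩
  · simp [hU, hsymm x y, mul_comm (S.unit x)]
  · have hR : (0 : ℝ) < S.rank := by exact_mod_cast hrank
    set κ := B ν (φ ⟨0, hrank⟩)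
    have hκν := hκ ν
    rw [hνU, hνB] at hκν
    have hκ' : κ = k + (S.rank - 1) * c := by
      have : (S.rank : ℝ) * (k + (S.rank - 1) * c) = S.rank * κ := by rw [hκν]; ring
      exact (mul_left_cancel₀ hR.ne' this).symm
    suffices h : 0 < B x x - c * (S.unit x * S.unit x) by
      simpa [hU] using mul_pos (inv_pos.2 hkc) h
    set y := x - (S.unit x / S.rank) • ν
    have hy : B y y = B x x - (S.unit x * S.unit x) * κ / S.rank := by
      simp only [y, map_sub, map_smul, LinearMap.sub_apply, LinearMap.smul_apply, smul_eq_mul,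
        hsymm x ν, hκ, hνU]
      field_simp
      ring
    have hy' : B x x - c * (S.unit x * S.unit x)
        = B y y + (S.unit x * S.unit x) * ((k - c) / S.rank) := by
      rw [hy, hκ']
      field_simp
      ring
    rw [hy']
    rcases eq_or_ne y 0 with h | h
    · have hx' : S.unit x ≠ 0 := by
        intro h0
        simp only [y, h0, zero_div, zero_smul, sub_zero] at h
        exact hx h
      rw [h]
      simpa using mul_pos (mul_self_pos.2 hx') (div_pos hkc hR)
    · exact add_pos_of_pos_of_nonneg (hpos y h)
        (mul_nonneg (mul_self_nonneg _) (div_pos hkc hR).le)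
  · simp only [LinearMap.smul_apply, LinearMap.sub_apply, hU, hB _ ψ hψ,
      S.unit_apply _ (hψ.1 _).1, smul_eq_mul]
    split_ifs
    · field_simp
    · ring
  · simp [hU, hinv T hT, hT.unit_apply]

/-- All frames are orthogonal with respect to an invariant self-dualizing inner product. -/
theorem IsInvariantSelfDualizing.exists_isFrameForm (h1 : S.ClassicalDecomposability)
    (h2 : S.StrongSymmetry) {B : LinearMap.BilinForm ℝ A} (hB : S.IsInvariantSelfDualizing B) :
    ∃ k : ℝ, 0 < k ∧ S.IsFrameForm (k⁻¹ • B) := by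
  obtain ⟨k, c, hk, hc, hfr⟩ := exists_frame_values h1 h2 hB.pos hB.invariant
  suffices hc0 : c = 0 by
    refine ⟨k, hk, fun x y => by simp [hB.symm x y],
      fun x hx => by simpa using mul_pos (inv_pos.2 hk) (hB.pos x hx), fun {n φ} hφ i j => ?_⟩
    simp only [LinearMap.smul_apply, hfr n φ hφ, hc0, smul_eq_mul]
    split_ifs
    · exact inv_mul_cancel₀ hk.ne'
    · ring
  by_contra hc0
  have hrank : 1 < S.rank := lt_of_le_of_ne (rank_pos h1) fun h => hc0 (hc h.symm)
  have hnonneg : ∀ x ∈ S.cone, ∀ y ∈ S.cone, 0 ≤ B x y := fun x hx y hy => by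
    have : y ∈ (S.cone : Set A) := hy
    rw [← hB.selfDual] at this
    exact this x hx
  obtain ⟨ψ, hψ⟩ := S.exists_isFrame_rank
  obtain ⟨hp, e, he, -, hd⟩ := id hψ
  have h01 : (⟨0, rank_pos h1⟩ : Fin S.rank) ≠ ⟨1, hrank⟩ := by simp
  have hc' : 0 < c := by
    refine lt_of_le_of_ne ?_ (Ne.symm hc0)
    have h := hfr _ ψ hψ ⟨0, rank_pos h1⟩ ⟨1, hrank⟩
    rw [if_neg h01] at h
    rw [← h]
    exact hnonneg _ (mem_cone_of_mem_states (hp _).1) _ (mem_cone_of_mem_states (hp _).1)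
  set ω := ψ ⟨0, rank_pos h1⟩
  obtain ⟨v, hv⟩ := exists_dual_vector hB.pos (e ⟨0, rank_pos h1⟩).toLinearMap
  have hvc : v ∈ S.cone := by
    change v ∈ (S.cone : Set A)
    rw [← hB.selfDual]
    intro x hx
    rw [hB.symm, hv]
    exact effects_nonneg_of_mem_cone (he _) hx
  obtain ⟨φ, r, hφ, hr, rfl⟩ := exists_decomposition_of_mem_cone h1 h2 hvc
  have hpure : ∀ τ ∈ S.states.extremePoints ℝ, B τ τ = k := fun τ hτ => by
    simpa using hfr 1 _ (isFrame_const hτ) 0 0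
  have hle : ∀ i, B (φ i) ω ≤ k := fun i => by
    rcases eq_or_ne (φ i) ω with h | h
    · rw [h, hpure _ (hp _)]
    · have := hB.pos _ (sub_ne_zero.2 h)
      simp only [map_sub, LinearMap.sub_apply, hpure _ (hp _), hpure _ (hφ.1 i), hB.symm ω, ω]
        at this
      linarith
  have hR : 1 ≤ (∑ i, r i) * k := by
    have h3 : B (∑ i, r i • φ i) ω = 1 := by
      rw [hv]
      simp [hd, ω]
    rw [← h3, Finset.sum_mul]
    simp only [map_sum, map_smul, LinearMap.sum_apply, LinearMap.smul_apply, smul_eq_mul]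
    exact Finset.sum_le_sum fun i _ => mul_le_mul_of_nonneg_left (hle i) (hr i)
  have hR' : (∑ i, r i) * (k + (S.rank - 1) * c) = 1 := by
    obtain ⟨ν, hν⟩ := exists_center h1 h2
    have h3 : B (∑ i, r i • φ i) ν = 1 := by
      rw [hv, ← hν ψ hψ]
      simp [hd]
    have : ∀ i j, B (φ i) (φ j) = (if i = j then k - c else 0) + c := fun i j => by
      rw [hfr _ φ hφ]
      split_ifs <;> ring
    refine Eq.trans ?_ h3
    rw [← hν φ hφ, Finset.sum_mul]
    simp only [map_sum, map_smul, LinearMap.sum_apply, LinearMap.smul_apply, smul_eq_mul, this,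
      mul_add, Finset.sum_add_distrib]
    simp [← Finset.sum_mul]
    ring
  have hRpos : 0 < ∑ i, r i := pos_of_mul_pos_left (one_pos.trans_le hR) hk.le
  have h1N : (1 : ℝ) < S.rank := by exact_mod_cast hrank
  have := mul_pos hRpos (mul_pos (sub_pos.2 h1N) hc')
  linarith

end ProbSystem

namespace ProbSystem

variable {A : Type*} [NormedAddCommGroup A] [NormedSpace ℝ A] {S : ProbSystem A}

section Faces

theorem mem_of_mem_span_face (F : S.Face) {x : A} (hx : x ∈ S.cone)
    (hxF : x ∈ Submodule.span ℝ (F.1 : Set A)) : x ∈ F.1 := by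
  have key : ∃ f ∈ F.1, ∃ g ∈ F.1, x + g = f := by
    clear hx
    induction hxF using Submodule.span_induction with
    | mem y hy => exact ⟨y, hy, 0, F.1.zero_mem, add_zero y⟩
    | zero => exact ⟨0, F.1.zero_mem, 0, F.1.zero_mem, add_zero 0⟩
    | add y z _ _ hy hz =>
      obtain ⟨f, hf, g, hg, e⟩ := hy
      obtain ⟨f', hf', g', hg', e'⟩ := hz
      exact ⟨f + f', add_mem hf hf', g + g', add_mem hg hg', by rw [← e, ← e']; abel⟩
    | smul a y _ hy =>
      obtain ⟨f, hf, g, hg, e⟩ := hy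
      rcases le_total 0 a with ha | ha
      · exact ⟨a • f, F.1.smul_mem ha hf, a • g, F.1.smul_mem ha hg, by rw [← e, smul_add]⟩
      · refine ⟨-a • g, F.1.smul_mem (neg_nonneg.2 ha) hg, -a • f,
          F.1.smul_mem (neg_nonneg.2 ha) hf, ?_⟩
        rw [← e]
        module
  obtain ⟨f, hf, g, hg, e⟩ := key
  exact F.2.mem_of_add_mem_left hx (F.2.le hg) (e ▸ hf)

/-- Every face is generated by one of its points. -/
theorem exists_face_generator [FiniteDimensional ℝ A] (F : S.Face) :
    ∃ x ∈ F.1, ∀ H : S.Face, x ∈ H.1 → F ≤ H := by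
  obtain ⟨b, hb, hspan, hli⟩ := exists_linearIndependent ℝ (F.1 : Set A)
  have := hli.setFinite.fintype
  refine ⟨∑ i : b, (i : A), sum_mem fun i _ => hb i.2, fun H hH y hy => ?_⟩
  refine mem_of_mem_span_face H (F.2.le hy) ?_
  have hbH : b ⊆ H.1 := fun z hz => H.2.mem_of_sum_mem (fun i => F.2.le (hb i.2)) hH ⟨z, hz⟩
  exact Submodule.span_mono hbH (hspan ▸ Submodule.subset_span hy)

/-- The face of points that are mapped into a face by a reversible transformation. -/
def Face.comap (F : S.Face) {T : A →L[ℝ] A} (hT : S.IsReversible T) : S.Face :=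
  ⟨S.cone ⊓ F.1.comap T.toLinearMap, inf_le_left, fun {x y a} hx hy ha h =>
    ⟨hx, F.2.mem_of_smul_add_mem (a := a) (hT.map_cone hx) (hT.map_cone hy) ha
      (by simpa using h.2)⟩⟩

theorem Face.mem_comap (F : S.Face) {T : A →L[ℝ] A} (hT : S.IsReversible T) {x : A} :
    x ∈ (F.comap hT).1 ↔ x ∈ S.cone ∧ T x ∈ F.1 := Iff.rfl

end Faces

/-- A finite set of pure states that are mutually orthogonal with respect to `B`. -/
def IsOrthoframe (S : ProbSystem A) (B : LinearMap.BilinForm ℝ A) (s : Finset A) : Prop :=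
  (∀ a ∈ s, a ∈ S.states.extremePoints ℝ) ∧ ∀ a ∈ s, ∀ b ∈ s, a ≠ b → B a b = 0

variable {B : LinearMap.BilinForm ℝ A}

theorem IsOrthoframe.mem_cone {s : Finset A} (hs : S.IsOrthoframe B s) {a : A} (ha : a ∈ s) :
    a ∈ S.cone :=
  mem_cone_of_mem_states (hs.1 a ha).1

theorem IsOrthoframe.mono {s t : Finset A} (ht : S.IsOrthoframe B t) (h : s ⊆ t) :
    S.IsOrthoframe B s :=
  ⟨fun a ha => ht.1 a (h ha), fun a ha b hb => ht.2 a (h ha) b (h hb)⟩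

namespace IsFrameForm

theorem isOrthoframe_union [DecidableEq A] (hB : S.IsFrameForm B) {s t : Finset A}
    (hs : S.IsOrthoframe B s) (ht : S.IsOrthoframe B t) (h : ∀ a ∈ s, ∀ b ∈ t, B a b = 0) :
    S.IsOrthoframe B (s ∪ t) := by
  refine ⟨fun a ha => (Finset.mem_union.1 ha).elim (hs.1 a) (ht.1 a), fun a ha b hb hab => ?_⟩
  rcases Finset.mem_union.1 ha with ha | ha <;> rcases Finset.mem_union.1 hb with hb | hb
  · exact hs.2 a ha b hb hab
  · exact h a ha b hb
  · rw [hB.symm]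
    exact h b hb a ha
  · exact ht.2 a ha b hb hab

theorem isOrthoframe_map (hB : S.IsFrameForm B) {n : ℕ} {φ : Fin n → A} (hφ : S.IsFrame φ)
    (s : Finset (Fin n)) : S.IsOrthoframe B (s.map ⟨φ, hφ.linearIndependent.injective⟩) := by
  refine ⟨fun a ha => ?_, fun a ha b hb hab => ?_⟩
  · obtain ⟨i, -, rfl⟩ := Finset.mem_map.1 ha
    exact hφ.1 i
  · obtain ⟨i, -, rfl⟩ := Finset.mem_map.1 ha
    obtain ⟨j, -, rfl⟩ := Finset.mem_map.1 hb
    exact (hB.frame hφ i j).trans (if_neg fun h => hab (by rw [h]))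

variable [FiniteDimensional ℝ A]

/-- The face of all points that are orthogonal to a given set of points of the cone. -/
def orthogonalFace (hB : S.IsFrameForm B) (h1 : S.ClassicalDecomposability)
    (h2 : S.StrongSymmetry) (Y : Set A) (hY : Y ⊆ S.cone) : S.Face :=
  ⟨{ carrier := {x | x ∈ S.cone ∧ ∀ y ∈ Y, B x y = 0}
     zero_mem' := ⟨S.cone.zero_mem, fun y _ => by simp⟩
     add_mem' := fun {x x'} hx hx' => ⟨add_mem hx.1 hx'.1, fun y hy => by
      simp [hx.2 y hy, hx'.2 y hy]⟩
     smul_mem' := fun c x hx => ⟨S.cone.smul_mem c.2 hx.1, fun y hy => by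
      have : B ((c : ℝ) • x) y = 0 := by
        rw [map_smul, LinearMap.smul_apply, hx.2 y hy, smul_zero]
      exact this⟩ },
    fun x hx => hx.1, fun {x x' a} hx hx' ha h => ⟨hx, fun y hy => by
      have h3 : B (a • x + x') y = 0 := h.2 y hy
      simp only [map_add, map_smul, LinearMap.add_apply, LinearMap.smul_apply, smul_eq_mul] at h3
      have h4 := mul_nonneg ha.le (hB.apply_nonneg h1 h2 hx (hY hy))
      have h5 := hB.apply_nonneg h1 h2 hx' (hY hy)
      have h6 : a * B x y = 0 := by linarith
      exact (mul_eq_zero.1 h6).resolve_left ha.ne'⟩⟩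

/-- The orthocomplement of a face. -/
def compl (hB : S.IsFrameForm B) (h1 : S.ClassicalDecomposability) (h2 : S.StrongSymmetry)
    (F : S.Face) : S.Face :=
  hB.orthogonalFace h1 h2 F.1 F.2.le

variable (hB : S.IsFrameForm B) (h1 : S.ClassicalDecomposability) (h2 : S.StrongSymmetry)

include hB h1 h2

theorem isFrame_enumeration {s : Finset A} (hs : S.IsOrthoframe B s) :
    S.IsFrame fun i => (s.equivFin.symm i : A) :=
  hB.isFrame_of_orthogonal h1 h2 (fun _ => hs.1 _ (Subtype.coe_prop _)) fun _ _ hij =>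
    hs.2 _ (Subtype.coe_prop _) _ (Subtype.coe_prop _) fun h =>
      hij (s.equivFin.symm.injective (Subtype.ext h))

theorem card_le_rank {s : Finset A} (hs : S.IsOrthoframe B s) : s.card ≤ S.rank :=
  (hB.isFrame_enumeration h1 h2 hs).le_rank

theorem exists_orthoframe_extension {s : Finset A} (hs : S.IsOrthoframe B s) :
    ∃ t, s ⊆ t ∧ S.IsOrthoframe B t ∧ t.card = S.rank := by
  obtain ⟨ψ, hψ, h⟩ := (hB.isFrame_enumeration h1 h2 hs).exists_extension h2
  refine ⟨_, fun a ha => ?_, hB.isOrthoframe_map hψ Finset.univ, by simp⟩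
  refine Finset.mem_map.2 ⟨_, Finset.mem_univ _, (h (s.equivFin ⟨a, ha⟩)).trans ?_⟩
  simp

theorem exists_map_orthoframe {s t : Finset A} (hs : S.IsOrthoframe B s)
    (ht : S.IsOrthoframe B t) (hst : s.card ≤ t.card) :
    ∃ T : A →L[ℝ] A, S.IsReversible T ∧ ∀ a ∈ s, T a ∈ t := by
  obtain ⟨T, hT, h⟩ := h2 _ _ _ (hB.isFrame_enumeration h1 h2 hs)
    ((hB.isFrame_enumeration h1 h2 ht).comp (Fin.castLE_injective hst))
  refine ⟨T, hT, fun a ha => ?_⟩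
  have h3 := h (s.equivFin ⟨a, ha⟩)
  simp only [Equiv.symm_apply_apply, Function.comp_apply] at h3
  rw [h3]
  exact Subtype.coe_prop _

theorem exists_orthoframe_decomposition {x : A} (hx : x ∈ S.cone) :
    ∃ s, S.IsOrthoframe B s ∧ (∀ a ∈ s, 0 < B x a) ∧ x = ∑ a ∈ s, B x a • a := by
  obtain ⟨φ, r, hφ, hr, rfl⟩ := exists_decomposition_of_mem_cone h1 h2 hx
  refine ⟨_, hB.isOrthoframe_map hφ (Finset.univ.filter fun i => 0 < r i), fun a ha => ?_, ?_⟩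
  · obtain ⟨i, hi, rfl⟩ := Finset.mem_map.1 ha
    refine lt_of_lt_of_eq ?_ (hB.sum_smul_apply hφ r i).symm
    simpa using hi
  · rw [Finset.sum_map]
    simp only [Function.Embedding.coeFn_mk, hB.sum_smul_apply hφ]
    refine (Finset.sum_subset (Finset.filter_subset _ _) fun i _ hi => ?_).symm
    have : r i = 0 := le_antisymm (by simpa using hi) (hr i)
    rw [this, zero_smul]

/-- For a maximal orthoframe `t`, every face that contains `s ⊆ t` contains all points of the cone
that are orthogonal to the rest of `t`. -/
theorem mem_face_of_orthogonal {s t : Finset A} (ht : S.IsOrthoframe B t)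
    (htc : t.card = S.rank) (hst : s ⊆ t) (H : S.Face) (hH : ∀ a ∈ s, a ∈ H.1) {x : A}
    (hx : x ∈ S.cone) (hxt : ∀ y ∈ t, y ∉ s → B x y = 0) : x ∈ H.1 := by
  classical
  let F := hB.orthogonalFace h1 h2 (t \ s : Finset A)
    fun y hy => ht.mem_cone (Finset.mem_sdiff.1 hy).1
  have hF : ∀ z, z ∈ F.1 ↔ z ∈ S.cone ∧ ∀ y ∈ (t \ s : Finset A), B z y = 0 := fun z => Iff.rfl
  suffices h : F ≤ H from h ((hF x).2 ⟨hx, fun y hy => by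
    rw [Finset.mem_sdiff] at hy
    exact hxt y hy.1 hy.2⟩)
  obtain ⟨z, hz, hgen⟩ := exists_face_generator F
  obtain ⟨s', hs', hpos, e⟩ := hB.exists_orthoframe_decomposition h1 h2 (F.2.le hz)
  have hs'F : ∀ a ∈ s', a ∈ F.1 := fun a ha => by
    rw [e, ← Finset.sum_coe_sort s' fun a => B z a • a] at hz
    exact F.2.mem_of_sum_smul_mem (fun i => hs'.mem_cone i.2) (fun i => (hpos _ i.2).le) hz
      ⟨a, ha⟩ (hpos a ha)
  have hcard : s'.card ≤ s.card := by
    have hu := hB.isOrthoframe_union hs' (ht.mono Finset.sdiff_subset)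
      fun a ha b hb => ((hF a).1 (hs'F a ha)).2 b hb
    have hdisj : Disjoint s' (t \ s) := Finset.disjoint_left.2 fun a ha ha' => by
      have h3 := ((hF a).1 (hs'F a ha)).2 a ha'
      rw [hB.self_apply (hs'.1 a ha)] at h3
      exact one_ne_zero h3
    have h3 := hB.card_le_rank h1 h2 hu
    rw [Finset.card_union_of_disjoint hdisj, Finset.card_sdiff_of_subset hst, htc] at h3
    have := Finset.card_le_card hst
    omega
  obtain ⟨T, hT, hTs⟩ := hB.exists_map_orthoframe h1 h2 hs' (ht.mono hst) hcard
  have hsF : ∀ a ∈ s, a ∈ (H ⊓ F).1 := fun a ha => ⟨hH a ha, (hF a).2 ⟨ht.mem_cone (hst ha),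
    fun y hy => by
      rw [Finset.mem_sdiff] at hy
      exact ht.2 a (hst ha) y hy.1 fun h => hy.2 (h ▸ ha)⟩⟩
  have hle : F ≤ (H ⊓ F).comap hT := by
    refine hgen _ ((Face.mem_comap _ hT).2 ⟨F.2.le hz, ?_⟩)
    rw [e, map_sum]
    refine sum_mem fun a ha => ?_
    rw [map_smul]
    exact (H ⊓ F).1.smul_mem (hpos a ha).le (hsF _ (hTs a ha))
  have hinj : Function.Injective T := by
    obtain ⟨T', -, h, -⟩ := hT.exists_inverse
    exact Function.LeftInverse.injective h
  have hmap : (Submodule.span ℝ (F.1 : Set A)).map T.toLinearMap ≤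
      Submodule.span ℝ ((H ⊓ F).1 : Set A) := by
    rw [Submodule.map_span_le]
    exact fun y hy => Submodule.subset_span (hle hy).2
  have hspan : Submodule.span ℝ ((H ⊓ F).1 : Set A) = Submodule.span ℝ (F.1 : Set A) := by
    refine Submodule.eq_of_le_of_finrank_le (Submodule.span_mono fun y hy => hy.2) ?_
    rw [(Submodule.equivMapOfInjective T.toLinearMap hinj _).finrank_eq]
    exact Submodule.finrank_mono hmap
  intro y hy
  exact (mem_of_mem_span_face (H ⊓ F) (F.2.le hy) (hspan ▸ Submodule.subset_span hy)).1

/-- Every face consists of the points that are orthogonal to a part of a maximal orthoframe. -/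
theorem exists_orthoframe_of_face (F : S.Face) : ∃ s t, S.IsOrthoframe B t ∧ t.card = S.rank ∧
    s ⊆ t ∧ (∀ a ∈ s, a ∈ F.1) ∧
      ∀ x, x ∈ F.1 ↔ x ∈ S.cone ∧ ∀ y ∈ t, y ∉ s → B x y = 0 := by
  obtain ⟨z, hz, hgen⟩ := exists_face_generator F
  obtain ⟨s, hs, hpos, e⟩ := hB.exists_orthoframe_decomposition h1 h2 (F.2.le hz)
  obtain ⟨t, hst, ht, htc⟩ := hB.exists_orthoframe_extension h1 h2 hs
  have hsF : ∀ a ∈ s, a ∈ F.1 := fun a ha => by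
    rw [e, ← Finset.sum_coe_sort s fun a => B z a • a] at hz
    exact F.2.mem_of_sum_smul_mem (fun i => hs.mem_cone i.2) (fun i => (hpos _ i.2).le) hz
      ⟨a, ha⟩ (hpos a ha)
  refine ⟨s, t, ht, htc, hst, hsF, fun x => ⟨fun hx => ?_, fun hx =>
    hB.mem_face_of_orthogonal h1 h2 ht htc hst F hsF hx.1 hx.2⟩⟩
  have h3 := hgen (hB.orthogonalFace h1 h2 {y | y ∈ t ∧ y ∉ s} fun y hy => ht.mem_cone hy.1) ?_ hx
  · exact ⟨h3.1, fun y hy hys => h3.2 y ⟨hy, hys⟩⟩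
  · rw [e]
    refine sum_mem fun a ha => Submodule.smul_mem _ (⟨_, (hpos a ha).le⟩ : {c : ℝ // 0 ≤ c}) ?_
    exact ⟨hs.mem_cone ha, fun y hy => ht.2 a (hst ha) y hy.1 fun h => hy.2 (h ▸ ha)⟩

theorem mem_compl (F : S.Face) {x : A} :
    x ∈ (hB.compl h1 h2 F).1 ↔ x ∈ S.cone ∧ ∀ y ∈ F.1, B x y = 0 := Iff.rfl

theorem mem_compl_of_orthogonal {F : S.Face} {s t : Finset A} (ht : S.IsOrthoframe B t)
    (htc : t.card = S.rank) (hst : s ⊆ t)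
    (hF : ∀ x ∈ F.1, ∀ y ∈ t, y ∉ s → B x y = 0) {x : A} (hx : x ∈ S.cone)
    (hxs : ∀ a ∈ s, B x a = 0) : x ∈ (hB.compl h1 h2 F).1 := by
  refine ⟨hx, fun y hy => ?_⟩
  rw [hB.symm]
  refine (hB.mem_face_of_orthogonal h1 h2 ht htc hst
    (hB.orthogonalFace h1 h2 {x} (by simpa using hx)) (fun a ha => ⟨ht.mem_cone (hst ha), ?_⟩)
    (F.2.le hy) (hF y hy)).2 x rfl
  rintro _ rfl
  rw [hB.symm]
  exact hxs a ha

theorem compl_compl (F : S.Face) : hB.compl h1 h2 (hB.compl h1 h2 F) = F := by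
  obtain ⟨s, t, ht, htc, hst, hs, hF⟩ := hB.exists_orthoframe_of_face h1 h2 F
  refine le_antisymm (fun x hx => (hF x).2 ⟨hx.1, fun y hy hys => hx.2 y ?_⟩) fun x hx =>
    ⟨F.2.le hx, fun y hy => by rw [hB.symm]; exact hy.2 x hx⟩
  exact hB.mem_compl_of_orthogonal h1 h2 ht htc hst (fun z hz => ((hF z).1 hz).2)
    (ht.mem_cone hy) fun a ha => ht.2 y hy a (hst ha) fun h => hys (h ▸ ha)

theorem compl_le_compl {F G : S.Face} (h : F ≤ G) : hB.compl h1 h2 G ≤ hB.compl h1 h2 F :=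
  fun _ hx => ⟨hx.1, fun y hy => hx.2 y (h hy)⟩

theorem eq_zero_of_mem_compl {F : S.Face} {x : A} (hx : x ∈ F.1)
    (hx' : x ∈ (hB.compl h1 h2 F).1) : x = 0 :=
  hB.eq_zero (hx'.2 x hx)

/-- A face that has no nonzero points orthogonal to a smaller face is equal to it. -/
theorem le_of_inf_compl {F G : S.Face} (hFG : F ≤ G)
    (h : ∀ x ∈ G.1, x ∈ (hB.compl h1 h2 F).1 → x = 0) : G ≤ F := by
  classical
  obtain ⟨s, t, ht, htc, hst, hs, hF⟩ := hB.exists_orthoframe_of_face h1 h2 F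
  obtain ⟨s', t', ht', htc', hst', hs', hG⟩ := hB.exists_orthoframe_of_face h1 h2 G
  have hu : S.IsOrthoframe B (s ∪ t' \ s') :=
    hB.isOrthoframe_union (ht.mono hst) (ht'.mono Finset.sdiff_subset) fun a ha b hb => by
      rw [Finset.mem_sdiff] at hb
      exact ((hG a).1 (hFG (hs a ha))).2 b hb.1 hb.2
  obtain ⟨q, huq, hq, hqc⟩ := hB.exists_orthoframe_extension h1 h2 hu
  have hqu : ∀ y ∈ q, y ∈ s ∪ t' \ s' := by
    intro y hy
    by_contra hyu
    have ho : ∀ a ∈ s ∪ t' \ s', B y a = 0 := fun a ha =>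
      hq.2 y hy a (huq ha) fun h => hyu (h ▸ ha)
    have hy0 : y = 0 := by
      refine h y ((hG y).2 ⟨hq.mem_cone hy, fun a ha ha' => ho a ?_⟩)
        (hB.mem_compl_of_orthogonal h1 h2 ht htc hst (fun z hz => ((hF z).1 hz).2)
          (hq.mem_cone hy) fun a ha => ho a (Finset.mem_union_left _ ha))
      exact Finset.mem_union_right _ (Finset.mem_sdiff.2 ⟨ha, ha'⟩)
    have h3 := hB.self_apply (hq.1 y hy)
    simp [hy0] at h3
  intro x hx
  refine hB.mem_face_of_orthogonal h1 h2 hq hqc (Finset.subset_union_left.trans huq) F hs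
    (G.2.le hx) fun y hy hys => ?_
  have hy' := Finset.mem_sdiff.1 ((Finset.mem_union.1 (hqu y hy)).resolve_left hys)
  exact ((hG x).1 hx).2 y hy'.1 hy'.2

theorem isOrthomodularLattice : IsOrthomodularLattice S.Face (hB.compl h1 h2) where
  compl_compl := hB.compl_compl h1 h2
  compl_le_compl _ _ := hB.compl_le_compl h1 h2
  inf_compl F := le_bot_iff.1 fun _ hx => hB.eq_zero_of_mem_compl h1 h2 hx.1 hx.2
  sup_compl F := by
    refine le_antisymm le_top (hB.le_of_inf_compl h1 h2 le_top fun x _ hx => ?_)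
    have h3 := hB.compl_le_compl h1 h2 (le_sup_left (b := hB.compl h1 h2 F)) hx
    have h4 : hB.compl h1 h2 F ≤ F ⊔ hB.compl h1 h2 F := le_sup_right
    exact hB.eq_zero_of_mem_compl h1 h2 (h4 h3) hx
  orthomodular F G hFG := by
    have hle : F ⊔ G ⊓ hB.compl h1 h2 F ≤ G := sup_le hFG inf_le_left
    refine le_antisymm (hB.le_of_inf_compl h1 h2 hle fun x hx hx' => ?_) hle
    have h3 := hB.compl_le_compl h1 h2 (le_sup_left (b := G ⊓ hB.compl h1 h2 F)) hx'
    have h4 : G ⊓ hB.compl h1 h2 F ≤ F ⊔ G ⊓ hB.compl h1 h2 F := le_sup_right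
    exact hB.eq_zero_of_mem_compl h1 h2 (h4 ⟨hx, h3⟩) hx'

end IsFrameForm

end ProbSystem

theorem mainTheorem5 {A : Type*} [NormedAddCommGroup A] [NormedSpace ℝ A] [FiniteDimensional ℝ A]
    (S : ProbSystem A) (h1 : S.ClassicalDecomposability) (h2 : S.StrongSymmetry) :
    (∃ B : LinearMap.BilinForm ℝ A, S.IsInvariantSelfDualizing B) ∧
    ∀ B : LinearMap.BilinForm ℝ A, S.IsInvariantSelfDualizing B →
      ∃ c : S.Face → S.Face,
        (∀ F : S.Face, ((c F).1 : Set A) = {x : A | ∀ y ∈ F.1, B x y = 0} ∩ (S.cone : Set A)) ∧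
        IsOrthomodularLattice S.Face c := by
  refine ⟨?_, fun B hB => ?_⟩
  · obtain ⟨B, hB, hinv⟩ := ProbSystem.exists_invariant_frameForm h1 h2
    exact ⟨B, hB.symm, hB.pos, hB.selfDual h1 h2, hinv⟩
  · obtain ⟨k, hk, hB'⟩ := hB.exists_isFrameForm h1 h2
    refine ⟨hB'.compl h1 h2, fun F => ?_, hB'.isOrthomodularLattice h1 h2⟩
    ext x
    simp only [SetLike.mem_coe, hB'.mem_compl h1 h2, LinearMap.smul_apply, smul_eq_mul,
      mul_eq_zero, inv_eq_zero, hk.ne', false_or]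
    exact and_comm
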